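/- **Definitions.** A *strong proximity lattice* $(S,\prec)$ is a bounded distributive lattice $S$ with a relation $\prec$ on $S$ such that $\prec\circ\prec\;=\;\prec$; $\{a\mid a\prec b\}$ is an ideal and $\{b\mid a\prec b\}$ is a filter for all $b$, resp. $a$; $a\prec 0$ implies $a=0$; $a\prec b\vee c$ implies $a\le b'\vee c'$ for some $b'\prec b$, $c'\prec c$; $1\prec a$ implies $a=1$; and $b\wedge c\prec a$ implies $b'\wedge c'\le a$ for some $b'\succ b$, $c'\succ c$. Its dual $S^d$ is the opposite lattice with the relation $\succ$. Write $\mathrm{Fin}(S)$ for the set of finite subsets of $S$; a comma denotes union, and $a$ stands for $\{a\}$. An *entailment relation* on a set $S$ is a relation $\vdash$ on $\mathrm{Fin}(S)$ such that $a\vdash a$; $A\vdash B$ implies $A',A\vdash B,B'$; and $A\vdash B,a$ together with $a,A\vdash B$ implies $A\vdash B$. The entailment relation generated by a set of axioms is the smallest one containing them. For $\prec\;\subseteq S\times S$, let $A\prec_U B$ mean $\forall b\in B\,\exists a\in A\,(a\prec b)$ and $A\prec_L B$ mean $\forall a\in A\,\exists b\in B\,(a\prec b)$. A *strong continuous entailment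 relation* $(S,\vdash,\prec)$ is an entailment relation $(S,\vdash)$ with an idempotent relation $\prec$ on $S$ such that, for all $A,B\in\mathrm{Fin}(S)$, $$\exists A'\,(A\prec_U A'\vdash B)\iff \exists B'\,(A\vdash B'\prec_L B);$$ $A\ll B$ denotes this common condition. Its dual $(S,\vdash,\prec)^d$ is $(S,\dashv,\succ)$. For $\mathcal U\in\mathrm{Fin}(\mathrm{Fin}(S))$, let $\mathcal U^*$ be the set of all unions $\bigcup_{A\in\mathcal U}C_A$ with $\emptyset\ne C_A\subseteq A$. The cut composition of $r\subseteq\mathrm{Fin}(S)\times\mathrm{Fin}(S')$ and $s\subseteq\mathrm{Fin}(S')\times\mathrm{Fin}(S'')$ is given by: $A\,(s\cdot r)\,C$ iff there is $\mathcal V\in\mathrm{Fin}(\mathrm{Fin}(S'))$ with $A\,r\,B'$ for all $B'\in\mathcal V^*$ and $B\,s\,C$ for all $B\in\mathcal V$. A *join-preserving proximity map* $(S,\vdash,\prec)\to(S',\vdash',\prec')$ is a relation $r\subseteq\mathrm{Fin}(S)\times\mathrm{Fin}(S')$ such that $A\,r\,B$ implies $(A\cup A')\,r\,(B\cup B')$;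 $\ll'\cdot\, r=r=r\,\cdot\ll$; and whenever $A\,r\,B$ there is $\mathcal U\in\mathrm{Fin}(\mathrm{Fin}(S))$ with $A\vdash C$ for all $C\in\mathcal U^*$ and, for each $A'\in\mathcal U$, some $b\in B$ with $A'\,r\,\{b\}$. These are the morphisms of the category of strong continuous entailment relations; composition is cut composition and the identity is $\ll$. Write $\cong$ for isomorphism in this category. For a strong proximity lattice $(S,\prec)$ consider the following strong continuous entailment relations. * $\mathrm{P_U}(S)=(S,\vdash_U,\prec)$ (the presentation of the upper powerlocale), with $\vdash_U$ generated by $\ \vdash_U 1$; $\ a,b\vdash_U a\wedge b$; $\ a\vdash_U b$ if $a\le b$. * $\mathrm{P_L}(S)=(S,\vdash_L,\prec)$ (the presentation of the lower powerlocale), with $\vdash_L$ generated by $\ 0\vdash_L$; $\ a\vee b\vdash_L a,b$; $\ a\vdash_L b$ if $a\le b$. * $\Sigma(S)=(S,\vdash_\Sigma,\succ)$ (the presentation of the Scott topology), with $\vdash_\Sigma$ generated by $\ \vdash_\Sigma 0$; $\ a,b\vdash_\Sigma a\vee b$; $\ a\vdash_\Sigma b$ if $b\le a$. **Theorem.** For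 every strong proximity lattice $S$, 1. $\mathrm{P_U}(S)^d\cong \mathrm{P_L}(S^d)$ and $\mathrm{P_L}(S)^d\cong \mathrm{P_U}(S^d)$; 2. $\Sigma(S^d)\cong \mathrm{P_U}(S)$ and $\Sigma(S)^d\cong \mathrm{P_L}(S)$. -/

import Mathlib

noncomputable section

namespace StablyCompact

open scoped Classical

/-! ### Strong proximity lattices -/

/-- Proximity relations between bounded distributive lattices: every `{a | r a b}` is an ideal and
every `{b | r a b}` is a filter. -/
structure IsProximityRel {S T : Type*} [DistribLattice S] [BoundedOrder S]
    [DistribLattice T] [BoundedOrder T] (r : S → T → Prop) : Prop where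
  ideal : ∀ b : T, Order.IsIdeal {a : S | r a b}
  filter : ∀ a : S, Order.IsPFilter {b : T | r a b}

/-- Join-preserving proximity relations. -/
structure IsJoinPreservingRel {S T : Type*} [DistribLattice S] [BoundedOrder S]
    [DistribLattice T] [BoundedOrder T] (r : S → T → Prop) : Prop
    extends IsProximityRel r where
  eq_bot : ∀ a : S, r a ⊥ → a = ⊥
  sup : ∀ (a : S) (b c : T), r a (b ⊔ c) → ∃ b' c' : S, a ≤ b' ⊔ c' ∧ r b' b ∧ r c' c

/-- A strong proximity lattice with underlying bounded distributive lattice `S`: an idempotent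
join-preserving proximity relation on `S` which also satisfies the two dual conditions. -/
structure StrongProximityLattice (S : Type*) [DistribLattice S] [BoundedOrder S] where
  prec : S → S → Prop
  joinPreserving : IsJoinPreservingRel prec
  idem : Relation.Comp prec prec = prec
  eq_top : ∀ a : S, prec ⊤ a → a = ⊤
  inf : ∀ a b c : S, prec (b ⊓ c) a → ∃ b' c' : S, prec b b' ∧ prec c c' ∧ b' ⊓ c' ≤ a

namespace StrongProximityLattice

variable {S : Type*} [DistribLattice S] [BoundedOrder S]

/-- The dual of a strong proximity lattice: opposite lattice, converse relation. -/
def dual (P : StrongProximityLattice S) : StrongProximityLattice Sᵒᵈ where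
  prec a b := P.prec (OrderDual.ofDual b) (OrderDual.ofDual a)
  joinPreserving :=
    { ideal := fun b => P.joinPreserving.filter (OrderDual.ofDual b)
      filter := fun a => P.joinPreserving.ideal (OrderDual.ofDual a)
      eq_bot := fun a h => P.eq_top (OrderDual.ofDual a) h
      sup := fun a b c h => by
        obtain ⟨b', c', h1, h2, h3⟩ := P.inf (OrderDual.ofDual a) (OrderDual.ofDual b)
          (OrderDual.ofDual c) h
        exact ⟨OrderDual.toDual b', OrderDual.toDual c', h3, h1, h2⟩ }
  idem := by
    funext a b
    apply propext
    constructor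
    · rintro ⟨c, h1, h2⟩
      have h : Relation.Comp P.prec P.prec (OrderDual.ofDual b) (OrderDual.ofDual a) :=
        ⟨OrderDual.ofDual c, h2, h1⟩
      rw [P.idem] at h
      exact h
    · intro h
      have h' : Relation.Comp P.prec P.prec (OrderDual.ofDual b) (OrderDual.ofDual a) := by
        rw [P.idem]
        exact h
      obtain ⟨c, h1, h2⟩ := h'
      exact ⟨OrderDual.toDual c, h2, h1⟩
  eq_top := fun a h => P.joinPreserving.eq_bot (OrderDual.ofDual a) h
  inf := fun a b c h => by
    obtain ⟨b', c', h1, h2, h3⟩ := P.joinPreserving.sup (OrderDual.ofDual a) (OrderDual.ofDual b)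
      (OrderDual.ofDual c) h
    exact ⟨OrderDual.toDual b', OrderDual.toDual c', h2, h3, h1⟩

end StrongProximityLattice

/-! ### Entailment relations -/

section Entailment

variable {S T U : Type*}

/-- Entailment relations on a set: reflexivity, monotonicity (weakening) and cut. -/
structure IsEntailmentRel (e : Finset S → Finset S → Prop) : Prop where
  refl : ∀ a : S, e {a} {a}
  mono : ∀ A A' B B' : Finset S, e A B → e (A' ∪ A) (B ∪ B')
  cut : ∀ (A B : Finset S) (a : S), e A (B ∪ {a}) → e ({a} ∪ A) B → e A B

/-- The smallest entailment relation that contains a given set of axioms. -/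
def Generated (ax : Finset S → Finset S → Prop) (A B : Finset S) : Prop :=
  ∀ e : Finset S → Finset S → Prop, IsEntailmentRel e → (∀ C D, ax C D → e C D) → e A B

/-- The extension `A ≺_L B`: every member of `A` is below some member of `B`. -/
def LowerExt (prec : S → S → Prop) (A B : Finset S) : Prop :=
  ∀ a ∈ A, ∃ b ∈ B, prec a b

/-- The extension `A ≺_U B`: every member of `B` is above some member of `A`. -/
def UpperExt (prec : S → S → Prop) (A B : Finset S) : Prop :=
  ∀ b ∈ B, ∃ a ∈ A, prec a b

/-- A strong continuous entailment relation on the set `S`. -/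
structure StrongContEnt (S : Type*) where
  ent : Finset S → Finset S → Prop
  isEntailment : IsEntailmentRel ent
  prec : S → S → Prop
  idem : Relation.Comp prec prec = prec
  cont : ∀ A B : Finset S,
    (∃ A' : Finset S, UpperExt prec A A' ∧ ent A' B) ↔
      (∃ B' : Finset S, ent A B' ∧ LowerExt prec B' B)

/-- The relation `≪` of a strong continuous entailment relation: first `≺_U`, then entailment. -/
def StrongContEnt.ll (X : StrongContEnt S) : Finset S → Finset S → Prop :=
  Relation.Comp (UpperExt X.prec) X.ent

/-- The dual of a strong continuous entailment relation: both relations are reversed. -/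
def StrongContEnt.dual (X : StrongContEnt S) : StrongContEnt S where
  ent A B := X.ent B A
  isEntailment :=
    { refl := X.isEntailment.refl
      mono := fun A A' B B' h => by
        rw [Finset.union_comm A' A, Finset.union_comm B B']
        exact X.isEntailment.mono B B' A A' h
      cut := fun A B a h1 h2 => by
        rw [Finset.union_comm] at h1 h2
        exact X.isEntailment.cut B A a h2 h1 }
  prec a b := X.prec b a
  idem := by
    funext a b
    apply propext
    constructor
    · rintro ⟨c, h1, h2⟩
      have h : Relation.Comp X.prec X.prec b a := ⟨c, h2, h1⟩
      rwa [X.idem] at h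
    · intro h
      have h' : Relation.Comp X.prec X.prec b a := by rwa [X.idem]
      obtain ⟨c, h1, h2⟩ := h'
      exact ⟨c, h2, h1⟩
  cont A B := by
    constructor
    · rintro ⟨A', h1, h2⟩
      obtain ⟨B', h3, h4⟩ := (X.cont B A).2 ⟨A', h2, h1⟩
      exact ⟨B', h4, h3⟩
    · rintro ⟨B', h1, h2⟩
      obtain ⟨A', h3, h4⟩ := (X.cont B A).1 ⟨B', h2, h1⟩
      exact ⟨A', h4, h3⟩

/-! ### Proximity maps -/

/-- The family `𝒰*` of all unions `⋃_{A ∈ 𝒰} C_A` with `∅ ≠ C_A ⊆ A`, in closed form: the subsets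
of `⋃ 𝒰` that meet every member of `𝒰`. The lemmas `star_empty` and `star_insert` are its usual
recursive definition. -/
def star (𝒰 : Finset (Finset S)) : Finset (Finset S) :=
  (𝒰.sup id).powerset.filter fun B => ∀ A ∈ 𝒰, (B ∩ A).Nonempty

theorem mem_star {𝒰 : Finset (Finset S)} {B : Finset S} :
    B ∈ star 𝒰 ↔ B ⊆ 𝒰.sup id ∧ ∀ A ∈ 𝒰, (B ∩ A).Nonempty := by
  simp [star]

theorem star_empty : star (∅ : Finset (Finset S)) = {∅} := by
  ext B
  simp [mem_star]

theorem star_insert (𝒰 : Finset (Finset S)) (A D : Finset S) :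
    D ∈ star (𝒰 ∪ {A}) ↔
      ∃ B ∈ star 𝒰, ∃ C : Finset S, C ⊆ A ∧ C.Nonempty ∧ D = B ∪ C := by
  simp only [mem_star]
  constructor
  · rintro ⟨h1, h2⟩
    refine ⟨D ∩ 𝒰.sup id, ⟨Finset.inter_subset_right, fun A' hA' => ?_⟩, D ∩ A,
      Finset.inter_subset_right, h2 A (by simp), ?_⟩
    · obtain ⟨x, hx⟩ := h2 A' (by simp [hA'])
      rw [Finset.mem_inter] at hx
      refine ⟨x, ?_⟩
      simp only [Finset.mem_inter, Finset.mem_sup, id]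
      exact ⟨⟨hx.1, A', hA', hx.2⟩, hx.2⟩
    · rw [← Finset.inter_union_distrib_left]
      refine (Finset.inter_eq_left.2 ?_).symm
      rwa [Finset.sup_union, Finset.sup_singleton] at h1
  · rintro ⟨B, ⟨h1, h2⟩, C, h3, h4, rfl⟩
    refine ⟨?_, fun A' hA' => ?_⟩
    · rw [Finset.sup_union, Finset.sup_singleton]
      exact Finset.union_subset_union h1 h3
    · rw [Finset.mem_union, Finset.mem_singleton] at hA'
      rcases hA' with hA' | rfl
      · exact (h2 A' hA').mono (Finset.inter_subset_inter_right Finset.subset_union_left)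
      · obtain ⟨x, hx⟩ := h4
        exact ⟨x, by simp [hx, h3 hx]⟩

/-- Upper relations between finite subsets. -/
def IsUpper (r : Finset S → Finset T → Prop) : Prop :=
  ∀ (A A' : Finset S) (B B' : Finset T), r A B → r (A ∪ A') (B ∪ B')

/-- The cut composition `s · r` (first `r`, then `s`). -/
def cutComp (s : Finset T → Finset U → Prop) (r : Finset S → Finset T → Prop) :
    Finset S → Finset U → Prop := fun A C =>
  ∃ 𝒱 : Finset (Finset T), (∀ B' ∈ star 𝒱, r A B') ∧ ∀ B ∈ 𝒱, s B C

/-- The extension of `r` to finite families of finite sets. -/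
def approxExt (r : Finset S → Finset T → Prop) (𝒰 : Finset (Finset S)) (𝒱 : Finset (Finset T)) :
    Prop :=
  ∀ A ∈ 𝒰, ∀ B ∈ star 𝒱, r A B

/-- Proximity maps between strong continuous entailment relations. -/
structure IsProximityMap (X : StrongContEnt S) (Y : StrongContEnt T)
    (r : Finset S → Finset T → Prop) : Prop where
  upper : IsUpper r
  comp_left : cutComp Y.ll r = r
  comp_right : cutComp r X.ll = r

/-- Join-preserving proximity maps: the morphisms of the category of strong continuous entailment
relations, where composition is cut composition and the identity of `X` is `X.ll`. -/
structure IsJoinPreservingMap (X : StrongContEnt S) (Y : StrongContEnt T)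
    (r : Finset S → Finset T → Prop) : Prop extends IsProximityMap X Y r where
  join : ∀ (A : Finset S) (B : Finset T), r A B →
    ∃ 𝒰 : Finset (Finset S), approxExt X.ent {A} 𝒰 ∧ ∀ A' ∈ 𝒰, ∃ b ∈ B, r A' {b}

/-- Isomorphism in the category of strong continuous entailment relations and join-preserving
proximity maps. -/
def Isomorphic (X : StrongContEnt S) (Y : StrongContEnt T) : Prop :=
  ∃ (r : Finset S → Finset T → Prop) (s : Finset T → Finset S → Prop),
    IsJoinPreservingMap X Y r ∧ IsJoinPreservingMap Y X s ∧
      cutComp s r = X.ll ∧ cutComp r s = Y.ll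

end Entailment

/-! ### The three constructions -/

section Constructions

variable {S : Type*} [DistribLattice S] [BoundedOrder S]

/-- Axioms for the upper powerlocale. -/
inductive UpperAx : Finset S → Finset S → Prop
  | top : UpperAx ∅ {⊤}
  | inf (a b : S) : UpperAx {a, b} {a ⊓ b}
  | le (a b : S) : a ≤ b → UpperAx {a} {b}

/-- Axioms for the lower powerlocale. -/
inductive LowerAx : Finset S → Finset S → Prop
  | bot : LowerAx {⊥} ∅
  | sup (a b : S) : LowerAx {a ⊔ b} {a, b}
  | le (a b : S) : a ≤ b → LowerAx {a} {b}

/-- Axioms for the Scott topology. -/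
inductive ScottAx : Finset S → Finset S → Prop
  | bot : ScottAx ∅ {⊥}
  | sup (a b : S) : ScottAx {a, b} {a ⊔ b}
  | le (a b : S) : b ≤ a → ScottAx {a} {b}

theorem generated_isEntailmentRel {S : Type*} (ax : Finset S → Finset S → Prop) :
    IsEntailmentRel (Generated ax) where
  refl a := fun _ he _ => he.refl a
  mono A A' B B' h := fun e he hax => he.mono A A' B B' (h e he hax)
  cut A B a h1 h2 := fun e he hax => he.cut A B a (h1 e he hax) (h2 e he hax)

theorem generated_of_ax {S : Type*} {ax : Finset S → Finset S → Prop} {A B : Finset S}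
    (h : ax A B) : Generated ax A B := fun _ _ hax => hax A B h

theorem IsEntailmentRel.weaken {S : Type*} {e : Finset S → Finset S → Prop}
    (he : IsEntailmentRel e) {A A' B B' : Finset S} (hA : A ⊆ A') (hB : B ⊆ B') (h : e A B) :
    e A' B' := by
  have := he.mono A A' B B' h
  rwa [Finset.union_eq_left.2 hA, Finset.union_eq_right.2 hB] at this

theorem generated_upper_iff (A B : Finset S) :
    Generated UpperAx A B ↔ ∃ b ∈ B, A.inf id ≤ b := by
  constructor
  · intro h
    refine h (fun A B => ∃ b ∈ B, A.inf id ≤ b) ⟨?_, ?_, ?_⟩ ?_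
    · intro a
      exact ⟨a, by simp, by simp⟩
    · rintro A A' B B' ⟨b, hb, h⟩
      exact ⟨b, by simp [hb], (Finset.inf_mono Finset.subset_union_right).trans h⟩
    · rintro A B a ⟨b, hb, h1⟩ ⟨c, hc, h2⟩
      rw [Finset.mem_union, Finset.mem_singleton] at hb
      rcases hb with hb | rfl
      · exact ⟨b, hb, h1⟩
      · refine ⟨c, hc, le_trans ?_ h2⟩
        rw [Finset.inf_union, Finset.inf_singleton]
        exact le_inf h1 le_rfl
    · rintro C D (_ | ⟨a, b⟩ | ⟨a, b, h⟩)
      · exact ⟨⊤, by simp, by simp⟩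
      · exact ⟨a ⊓ b, by simp, by simp⟩
      · exact ⟨b, by simp, by simpa using h⟩
  · rintro ⟨b, hb, h⟩ e he hax
    have key : ∀ A : Finset S, e A {A.inf id} := by
      intro A
      induction A using Finset.induction_on with
      | empty => simpa using hax _ _ UpperAx.top
      | insert a A ha ih =>
        rw [Finset.inf_insert, id]
        have h1 : e {a, A.inf id} {a ⊓ A.inf id} := hax _ _ (UpperAx.inf a _)
        refine he.cut _ _ (A.inf id) ?_ ?_
        · exact he.weaken (Finset.subset_insert a A) Finset.subset_union_right ih
        · refine he.weaken ?_ (Finset.Subset.refl _) h1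
          intro x hx
          simp only [Finset.mem_insert, Finset.mem_singleton, Finset.mem_union] at hx ⊢
          tauto
    refine he.cut A B (A.inf id) ?_ ?_
    · exact he.weaken (Finset.Subset.refl _) Finset.subset_union_right (key A)
    · exact he.weaken Finset.subset_union_left (Finset.singleton_subset_iff.2 hb)
        (hax _ _ (UpperAx.le _ _ h))

theorem generated_scott_iff (A B : Finset S) :
    Generated ScottAx A B ↔ ∃ b ∈ B, b ≤ A.sup id := by
  have h : (ScottAx : Finset S → Finset S → Prop) = (UpperAx (S := Sᵒᵈ)) := by
    funext C D
    apply propext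
    constructor
    · rintro (_ | ⟨a, b⟩ | ⟨a, b, h⟩)
      · exact UpperAx.top (S := Sᵒᵈ)
      · exact UpperAx.inf (S := Sᵒᵈ) a b
      · exact UpperAx.le (S := Sᵒᵈ) a b h
    · rintro (_ | ⟨a, b⟩ | ⟨a, b, h⟩)
      · exact ScottAx.bot (S := S)
      · exact ScottAx.sup (S := S) a b
      · exact ScottAx.le (S := S) a b h
  rw [h]
  exact generated_upper_iff (S := Sᵒᵈ) A B

theorem generated_swap {S : Type*} (ax : Finset S → Finset S → Prop) (A B : Finset S) :
    Generated ax A B ↔ Generated (fun C D => ax D C) B A := by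
  have aux : ∀ e : Finset S → Finset S → Prop, IsEntailmentRel e →
      IsEntailmentRel fun C D => e D C := fun e he =>
    ⟨he.refl, fun C C' D D' h => he.weaken Finset.subset_union_left Finset.subset_union_right h,
      fun C D a h1 h2 => he.cut D C a (by rwa [Finset.union_comm] at h2)
        (by rwa [Finset.union_comm] at h1)⟩
  exact ⟨fun h e he hax => h _ (aux e he) fun C D => hax D C,
    fun h e he hax => h _ (aux e he) fun C D => hax D C⟩

theorem generated_lower_iff (A B : Finset S) :
    Generated LowerAx A B ↔ ∃ a ∈ A, a ≤ B.sup id := by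
  have h : (fun C D : Finset S => LowerAx D C) = ScottAx := by
    funext C D
    apply propext
    constructor
    · rintro (_ | ⟨a, b⟩ | ⟨a, b, h⟩)
      · exact ScottAx.bot
      · exact ScottAx.sup a b
      · exact ScottAx.le b a h
    · rintro (_ | ⟨a, b⟩ | ⟨a, b, h⟩)
      · exact LowerAx.bot
      · exact LowerAx.sup a b
      · exact LowerAx.le b a h
  rw [generated_swap, h, generated_scott_iff]

theorem StrongProximityLattice.prec_inf (P : StrongProximityLattice S) {a b c : S}
    (h1 : P.prec a b) (h2 : P.prec a c) : P.prec a (b ⊓ c) := by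
  obtain ⟨d, hd, hb, hc⟩ := (P.joinPreserving.filter a).Directed b h1 c h2
  exact (P.joinPreserving.filter a).IsLowerSet (le_inf (α := S) hb hc) hd

theorem StrongProximityLattice.prec_mono (P : StrongProximityLattice S) {a b c d : S}
    (h1 : a ≤ b) (h2 : P.prec b c) (h3 : c ≤ d) : P.prec a d :=
  (P.joinPreserving.ideal d).IsLowerSet h1 ((P.joinPreserving.filter b).IsLowerSet h3 h2)

theorem StrongProximityLattice.prec_top (P : StrongProximityLattice S) (a : S) :
    P.prec a ⊤ := by
  obtain ⟨b, hb⟩ := (P.joinPreserving.filter a).Nonempty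
  exact P.prec_mono le_rfl hb le_top

theorem StrongProximityLattice.exists_of_inf_prec (P : StrongProximityLattice S)
    (A : Finset S) : ∀ b : S, P.prec (A.inf id) b →
    ∃ A' : Finset S, UpperExt P.prec A A' ∧ A'.inf id ≤ b := by
  induction A using Finset.induction_on with
  | empty =>
    intro b h
    refine ⟨∅, by simp [UpperExt], ?_⟩
    simpa using (P.eq_top b (by simpa using h)).ge
  | insert a A ha ih =>
    intro b h
    rw [Finset.inf_insert, id] at h
    obtain ⟨a', c, h1, h2, h3⟩ := P.inf b a _ h
    obtain ⟨A', h4, h5⟩ := ih c h2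
    refine ⟨insert a' A', ?_, ?_⟩
    · intro x hx
      rw [Finset.mem_insert] at hx
      rcases hx with rfl | hx
      · exact ⟨a, by simp, h1⟩
      · obtain ⟨y, hy, hyx⟩ := h4 x hx
        exact ⟨y, by simp [hy], hyx⟩
    · rw [Finset.inf_insert, id]
      exact (inf_le_inf_left a' h5).trans h3

theorem StrongProximityLattice.exists_of_upperExt (P : StrongProximityLattice S)
    (A A' : Finset S) (h : UpperExt P.prec A A') :
    ∃ c : S, A.inf id ≤ c ∧ P.prec c (A'.inf id) := by
  induction A' using Finset.induction_on with
  | empty => exact ⟨⊤, le_top, by simpa using P.prec_top ⊤⟩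
  | insert a A' ha ih =>
    obtain ⟨c, h1, h2⟩ := ih fun b hb => h b (by simp [hb])
    obtain ⟨d, hd, h3⟩ := h a (by simp)
    refine ⟨d ⊓ c, le_inf (Finset.inf_le (f := id) hd) h1, ?_⟩
    rw [Finset.inf_insert, id]
    exact P.prec_inf (P.prec_mono inf_le_left h3 le_rfl) (P.prec_mono inf_le_right h2 le_rfl)

theorem StrongProximityLattice.upper_cont (P : StrongProximityLattice S) (A B : Finset S) :
    (∃ A' : Finset S, UpperExt P.prec A A' ∧ ∃ b ∈ B, A'.inf id ≤ b) ↔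
      (∃ B' : Finset S, (∃ b ∈ B', A.inf id ≤ b) ∧ LowerExt P.prec B' B) := by
  constructor
  · rintro ⟨A', h1, b, hb, h2⟩
    obtain ⟨c, h3, h4⟩ := P.exists_of_upperExt A A' h1
    refine ⟨{c}, ⟨c, by simp, h3⟩, fun x hx => ⟨b, hb, ?_⟩⟩
    rw [Finset.mem_singleton.1 hx]
    exact P.prec_mono le_rfl h4 h2
  · rintro ⟨B', ⟨b', hb', h1⟩, h2⟩
    obtain ⟨b, hb, h3⟩ := h2 b' hb'
    obtain ⟨A', h4, h5⟩ := P.exists_of_inf_prec A b (P.prec_mono h1 h3 le_rfl)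
    exact ⟨A', h4, b, hb, h5⟩

namespace StrongProximityLattice

/-- `P_U(S)`, presenting the upper powerlocale. -/
def upper (P : StrongProximityLattice S) : StrongContEnt S where
  ent := Generated UpperAx
  isEntailment := generated_isEntailmentRel _
  prec := P.prec
  idem := P.idem
  cont A B := by
    simp only [generated_upper_iff]
    exact P.upper_cont A B

/-- `Σ(S)`, presenting the Scott topology; its idempotent relation is the converse of `≺`. -/
def scott (P : StrongProximityLattice S) : StrongContEnt S where
  ent := Generated ScottAx
  isEntailment := generated_isEntailmentRel _
  prec a b := P.prec b a
  idem := P.dual.idem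
  cont A B := by
    simp only [generated_scott_iff]
    exact P.dual.upper_cont A B

/-- `P_L(S)`, presenting the lower powerlocale. -/
def lower (P : StrongProximityLattice S) : StrongContEnt S where
  ent := Generated LowerAx
  isEntailment := generated_isEntailmentRel _
  prec := P.prec
  idem := P.idem
  cont A B := by
    have h := P.scott.dual.cont A B
    simp only [StrongContEnt.dual, scott, generated_scott_iff] at h
    simp only [generated_lower_iff]
    exact h

end StrongProximityLattice

end Constructions

end StablyCompact

end

namespace StablyCompact

open scoped Classical

/-! ### Multiple cuts in an entailment relation. -/

section Identity

variable {S : Type*}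

/-! In each of the four cases the two sides are the same structure on the same set, so the identity
morphism is the isomorphism. By `generated_upper_iff`, `generated_lower_iff` and
`generated_scott_iff`, `⊢_U`, `⊢_L` and `⊢_Σ` say respectively that the meet of `A` is below some `b
∈ B`, that some `a ∈ A` is below the join of `B`, and that some `b ∈ B` is below the join of `A`.
Swapping `A` with `B`, or reversing the lattice order, turns these conditions into one another, and
the relations `≺` match by definition.

What needs proof is that `≪` really is an identity morphism: it is join-preserving
(`ll_isJoinPreservingMap`) and idempotent under cut composition (`cutComp_ll`). The latter rests on
cutting along a whole family (`cut_star`), on continuity, and on interpolation for `≺_U`. -/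

/-- Simultaneous cut on all members of a finite set `V`. -/
theorem IsEntailmentRel.cut_finset {e : Finset S → Finset S → Prop} (he : IsEntailmentRel e)
    {A E : Finset S} (V : Finset S) (hV : e (V ∪ A) E) (h : ∀ v ∈ V, e A (E ∪ {v})) :
    e A E := by
  induction V using Finset.induction_on with
  | empty => simpa using hV
  | insert v V _ ih =>
    refine ih (he.cut _ _ v ?_ ?_) fun w hw => h w (Finset.mem_insert_of_mem hw)
    · exact he.weaken Finset.subset_union_right subset_rfl (h v (Finset.mem_insert_self v V))
    · rwa [← Finset.union_assoc, ← Finset.insert_eq]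

/-- Cut along a finite family `𝒱`, with side formulas `D`. -/
theorem IsEntailmentRel.cut_star {e : Finset S → Finset S → Prop} (he : IsEntailmentRel e)
    {A D : Finset S} (𝒱 : Finset (Finset S)) (h : ∀ B ∈ star 𝒱, e A (B ∪ D))
    (h𝒱 : ∀ V ∈ 𝒱, e V D) : e A D := by
  induction 𝒱 using Finset.induction_on with
  | empty => simpa using h ∅ (by simp [star_empty])
  | insert V 𝒱 _ ih =>
    refine ih (fun B hB => ?_) fun W hW => h𝒱 W (Finset.mem_insert_of_mem hW)
    -- All of `V` is cut at once: for `v ∈ V` the set `B ∪ {v}` is in the star of the enlarged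
    -- family, so `h` applies to it.
    refine he.cut_finset V ?_ fun v hv => ?_
    · exact he.weaken Finset.subset_union_left Finset.subset_union_right
        (h𝒱 V (Finset.mem_insert_self V 𝒱))
    · rw [Finset.union_right_comm]
      refine h _ ?_
      rw [Finset.insert_eq, Finset.union_comm, star_insert]
      exact ⟨B, hB, {v}, Finset.singleton_subset_iff.2 hv, Finset.singleton_nonempty v, rfl⟩

theorem IsEntailmentRel.self_of_nonempty {e : Finset S → Finset S → Prop}
    (he : IsEntailmentRel e) {A : Finset S} (hA : A.Nonempty) : e A A := by
  obtain ⟨a, ha⟩ := hA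
  exact he.weaken (Finset.singleton_subset_iff.2 ha) (Finset.singleton_subset_iff.2 ha) (he.refl a)

/-! ### The relation `≪` as an identity morphism. -/

namespace StrongContEnt

variable (X : StrongContEnt S)

theorem upperExt_trans {A B C : Finset S} (h1 : UpperExt X.prec A B) (h2 : UpperExt X.prec B C) :
    UpperExt X.prec A C := by
  intro c hc
  obtain ⟨b, hb, hbc⟩ := h2 c hc
  obtain ⟨a, ha, hab⟩ := h1 b hb
  refine ⟨a, ha, ?_⟩
  rw [← X.idem]
  exact ⟨b, hab, hbc⟩

/-- Idempotence of `≺` interpolates each `c ∈ C` separately; the finitely many interpolants form the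
middle set. -/
theorem exists_upperExt_between {A C : Finset S} (h : UpperExt X.prec A C) :
    ∃ B, UpperExt X.prec A B ∧ UpperExt X.prec B C := by
  have key : ∀ c : C, ∃ b, (∃ a ∈ A, X.prec a b) ∧ X.prec b c := by
    rintro ⟨c, hc⟩
    obtain ⟨a, ha, hac⟩ := h c hc
    rw [← X.idem] at hac
    obtain ⟨b, hab, hbc⟩ := hac
    exact ⟨b, ⟨a, ha, hab⟩, hbc⟩
  choose f hf hfc using key
  refine ⟨Finset.univ.image f, ?_, fun c hc => ⟨f ⟨c, hc⟩, by simp, hfc ⟨c, hc⟩⟩⟩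
  intro b hb
  obtain ⟨c, -, rfl⟩ := Finset.mem_image.1 hb
  exact hf c

theorem ll_iff {A B : Finset S} : X.ll A B ↔ ∃ B', X.ent A B' ∧ LowerExt X.prec B' B :=
  X.cont A B

theorem ll_isUpper : IsUpper X.ll := by
  rintro A A' B B' ⟨C, hC, h⟩
  refine ⟨C, fun c hc => ?_, X.isEntailment.weaken subset_rfl Finset.subset_union_left h⟩
  obtain ⟨a, ha, hac⟩ := hC c hc
  exact ⟨a, Finset.mem_union_left _ ha, hac⟩

/-- One inclusion is a cut along `𝒱` between two finite unions of witnesses; the other interpolates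
`≺_U` and uses a one-member family. -/
theorem cutComp_ll : cutComp X.ll X.ll = X.ll := by
  funext A C
  refine propext ⟨?_, ?_⟩
  · rintro ⟨𝒱, h1, h2⟩
    -- Continuity moves `≺` to the right here, so that nothing separates the two entailments at the
    -- members of `𝒱` and they can be cut.
    have h2' : ∀ V : 𝒱, ∃ D, X.ent V D ∧ LowerExt X.prec D C := fun V =>
      X.ll_iff.1 (h2 V V.2)
    have h1' : ∀ B : star 𝒱, ∃ A', UpperExt X.prec A A' ∧ X.ent A' B := fun B => h1 B B.2
    choose D hD hDC using h2'
    choose F hF hFB using h1'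
    have hA : UpperExt X.prec A (Finset.univ.biUnion F) := by
      intro a ha
      obtain ⟨B, -, hB⟩ := Finset.mem_biUnion.1 ha
      exact hF B a hB
    have hC : LowerExt X.prec (Finset.univ.biUnion D) C := by
      intro d hd
      obtain ⟨V, -, hV⟩ := Finset.mem_biUnion.1 hd
      exact hDC V d hV
    have hcut : X.ent (Finset.univ.biUnion F) (Finset.univ.biUnion D) := by
      refine X.isEntailment.cut_star 𝒱 (fun B hB => ?_) fun V hV => ?_
      · exact X.isEntailment.weaken
          (Finset.subset_biUnion_of_mem F (Finset.mem_univ ⟨B, hB⟩)) Finset.subset_union_left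
          (hFB ⟨B, hB⟩)
      · exact X.isEntailment.weaken subset_rfl
          (Finset.subset_biUnion_of_mem D (Finset.mem_univ ⟨V, hV⟩)) (hD ⟨V, hV⟩)
    -- Continuity moves `≺` back to the left, where transitivity of `≺_U` absorbs it.
    obtain ⟨A', hA', h⟩ := X.ll_iff.2 ⟨_, hcut, hC⟩
    exact ⟨A', X.upperExt_trans hA hA', h⟩
  · rintro ⟨A', hA', h⟩
    obtain ⟨V, hAV, hVA'⟩ := X.exists_upperExt_between hA'
    -- The star of `{V}` consists of the nonempty subsets of `V`, and a nonempty set entails itself.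
    refine ⟨{V}, fun B hB => ?_, fun W hW => ?_⟩
    · rw [mem_star, Finset.sup_singleton] at hB
      have hB' : B.Nonempty :=
        (hB.2 V (Finset.mem_singleton_self V)).mono Finset.inter_subset_left
      exact ⟨B, fun b hb => hAV b (hB.1 hb), X.isEntailment.self_of_nonempty hB'⟩
    · rw [Finset.mem_singleton.1 hW]
      exact ⟨A', hVA', h⟩

/-- The identity morphism. -/
theorem ll_isJoinPreservingMap : IsJoinPreservingMap X X X.ll where
  upper := X.ll_isUpper
  comp_left := X.cutComp_ll
  comp_right := X.cutComp_ll
  join A B h := by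
    obtain ⟨B', hAB', hB'⟩ := X.ll_iff.1 h
    -- For a family of singletons, every member of the star contains all of `B'`, so `A ⊢ B'`
    -- suffices.
    refine ⟨B'.image fun b => {b}, fun A' hA' C hC => ?_, fun A' hA' => ?_⟩
    · rw [Finset.mem_singleton.1 hA']
      refine X.isEntailment.weaken subset_rfl (fun b hb => ?_) hAB'
      obtain ⟨c, hc⟩ := (mem_star.1 hC).2 {b} (Finset.mem_image_of_mem _ hb)
      rw [Finset.mem_inter, Finset.mem_singleton] at hc
      exact hc.2 ▸ hc.1
    · obtain ⟨b', hb', rfl⟩ := Finset.mem_image.1 hA'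
      obtain ⟨b, hb, hbb⟩ := hB' b' hb'
      refine ⟨b, hb, X.ll_iff.2 ⟨{b'}, X.isEntailment.refl b', fun x hx => ?_⟩⟩
      exact ⟨b, Finset.mem_singleton_self b, Finset.mem_singleton.1 hx ▸ hbb⟩

end StrongContEnt

theorem Isomorphic.refl (X : StrongContEnt S) : Isomorphic X X :=
  ⟨X.ll, X.ll, X.ll_isJoinPreservingMap, X.ll_isJoinPreservingMap, X.cutComp_ll, X.cutComp_ll⟩

theorem Isomorphic.of_iff {X Y : StrongContEnt S} (hent : ∀ A B, X.ent A B ↔ Y.ent A B)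
    (hprec : ∀ a b, X.prec a b ↔ Y.prec a b) : Isomorphic X Y := by
  have h : X = Y := by
    obtain ⟨e, _, p, _, _⟩ := X
    obtain ⟨e', _, p', _, _⟩ := Y
    obtain rfl : e = e' := funext₂ fun A B => propext (hent A B)
    obtain rfl : p = p' := funext₂ fun a b => propext (hprec a b)
    rfl
  exact h ▸ Isomorphic.refl X

end Identity

end StablyCompact

theorem mainTheorem4 {S : Type*} [DistribLattice S] [BoundedOrder S]
    (P : StablyCompact.StrongProximityLattice S) :
    (StablyCompact.Isomorphic P.upper.dual P.dual.lower ∧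
      StablyCompact.Isomorphic P.lower.dual P.dual.upper) ∧
    (StablyCompact.Isomorphic P.dual.scott P.upper ∧
      StablyCompact.Isomorphic P.scott.dual P.lower) := by
  refine ⟨⟨?_, ?_⟩, ?_, ?_⟩
  -- `Sᵒᵈ` unfolds to `S`, and its joins and order to the meets and reversed order of `S`, so the
  -- two closed forms agree definitionally.
  · exact StablyCompact.Isomorphic.of_iff (S := S) (Y := P.dual.lower)
      (fun A B => (StablyCompact.generated_upper_iff B A).trans
        (StablyCompact.generated_lower_iff (S := Sᵒᵈ) A B).symm) fun _ _ => Iff.rfl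
  · exact StablyCompact.Isomorphic.of_iff (S := S) (Y := P.dual.upper)
      (fun A B => (StablyCompact.generated_lower_iff B A).trans
        (StablyCompact.generated_upper_iff (S := Sᵒᵈ) A B).symm) fun _ _ => Iff.rfl
  · exact StablyCompact.Isomorphic.of_iff (S := S) (X := P.dual.scott)
      (fun A B => (StablyCompact.generated_scott_iff (S := Sᵒᵈ) A B).trans
        (StablyCompact.generated_upper_iff A B).symm) fun _ _ => Iff.rfl
  · exact StablyCompact.Isomorphic.of_iff
      (fun A B => (StablyCompact.generated_scott_iff B A).trans
        (StablyCompact.generated_lower_iff A B).symm) fun _ _ => Iff.rfl
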